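/- Let $A$ and $B$ be unital $C^*$-algebras with $\mathbb Z_2$-gradings, i.e. involutive $*$-automorphisms $\alpha$ of $A$ and $\beta$ of $B$, and suppose $\alpha=\mathrm{ad}_u$, i.e. $\alpha(a)=uau^*$ for all $a\in A$, for some self-adjoint unitary $u\in A$. For $b\in B$ put $b_\pm=\tfrac12(b\pm\beta(b))$, and similarly in $A$ (even and odd components). Let $A \circledast B$ be the Fermi $C^*$-tensor product with its minimal $C^*$-norm: the completion of the algebraic tensor product of $A$ and $B$, with elementary tensors written $a \circledast b$ and with the product and involution determined, on homogeneous elements, by $(a \circledast b)(a' \circledast b')=\varepsilon(b,a')\,(aa') \circledast (bb')$ and $(a \circledast b)^*=\varepsilon(a,b)\,a^* \circledast b^*$, where $\varepsilon=-1$ if both arguments are odd and $\varepsilon=1$ otherwise, in the norm given by the direct sum of the GNS representations of the product states $\omega\times\varphi$, where $\omega,\varphi$ run over the even states ($\omega\circ\alpha=\omega$, $\varphi\circ\beta=\varphi$) of $A$ and $B$. It is graded by the involutive $*$-automorphism $\alpha \circledast \beta: a \circledast b\mapsto\alpha(a) \circledast \beta(b)$. Let $A\otimes B$ be the usual minimal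 (spatial) $C^*$-tensor product, graded by $\alpha\otimes\beta$. Then there is a $*$-isomorphism $\kappa: A \circledast B\to A\otimes B$ with $$\kappa(a \circledast b)=a\otimes b_+ + (au)\otimes b_-\qquad(a\in A,\ b\in B),$$ and it preserves the gradings: $\kappa\circ(\alpha \circledast \beta)=(\alpha\otimes\beta)\circ\kappa$. -/

import Mathlib

open scoped TensorProduct ENNReal ComplexOrder InnerProductSpace
open UniformSpace

universe u v w

noncomputable section

namespace FermiKlein

/-! ### Gradings -/

/-- A `ℤ₂`-grading of a unital C⋆-algebra, given by an involutive unital ⋆-automorphism. -/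
structure Grading (A : Type u) [CStarAlgebra A] where
  toHom : A →⋆ₐ[ℂ] A
  involutive : ∀ a, toHom (toHom a) = a

namespace Grading

variable {A : Type u} [CStarAlgebra A]

instance : CoeFun (Grading A) fun _ => A → A := ⟨fun α => α.toHom⟩

/-- The even component `a₊ = (a + α(a)) / 2`. -/
def even (α : Grading A) (a : A) : A := (2⁻¹ : ℂ) • (a + α a)

/-- The odd component `a₋ = (a - α(a)) / 2`. -/
def odd (α : Grading A) (a : A) : A := (2⁻¹ : ℂ) • (a - α a)

end Grading

/-! ### States -/

section States

variable (A : Type u) [CStarAlgebra A] [PartialOrder A] [StarOrderedRing A]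

/-- A state: a positive linear functional with value `1` at the unit. -/
structure State where
  functional : A →ₚ[ℂ] ℂ
  map_one : functional 1 = 1

variable {A}

/-- A state is even when it is invariant under the grading. -/
structure EvenState (α : Grading A) extends State A where
  even : ∀ a, functional (α a) = functional a

/-- The state `ω ∘ α`. -/
def State.comp (ω : State A) (α : Grading A) : State A where
  functional := ω.functional.comp (PositiveLinearMap.ofClass α.toHom)
  map_one := by
    change ω.functional (α.toHom 1) = 1
    rw [_root_.map_one, ω.map_one]

lemma State.comp_apply (ω : State A) (α : Grading A) (a : A) :
    (ω.comp α).functional a = ω.functional (α a) := rfl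

/-- The GNS Hilbert space of a state. -/
def State.H (ω : State A) : Type u := ω.functional.GNS

instance (ω : State A) : NormedAddCommGroup ω.H :=
  inferInstanceAs (NormedAddCommGroup ω.functional.GNS)

instance (ω : State A) : InnerProductSpace ℂ ω.H :=
  inferInstanceAs (InnerProductSpace ℂ ω.functional.GNS)

instance (ω : State A) : CompleteSpace ω.H :=
  inferInstanceAs (CompleteSpace ω.functional.GNS)

/-- The vector of the GNS space given by an element of the algebra. -/
def State.vec (ω : State A) (a : A) : ω.H :=
  ((ω.functional.toPreGNS a : ω.functional.PreGNS) : ω.functional.GNS)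

/-- The GNS representation of a state. -/
def State.rep (ω : State A) : A →⋆ₐ[ℂ] (ω.H →L[ℂ] ω.H) := ω.functional.gnsStarAlgHom

lemma State.inner_vec (ω : State A) (a b : A) :
    ⟪ω.vec a, ω.vec b⟫_ℂ = ω.functional (star a * b) :=
  Completion.inner_coe _ _

lemma State.rep_vec (ω : State A) (a b : A) : ω.rep a (ω.vec b) = ω.vec (a * b) :=
  ω.functional.gnsNonUnitalStarAlgHom_apply_coe

lemma State.denseRange_vec (ω : State A) : DenseRange ω.vec :=
  (Completion.denseRange_coe (α := ω.functional.PreGNS)).comp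
    ω.functional.toPreGNS.surjective.denseRange (Completion.continuous_coe _)

instance (ω : State A) : Nontrivial ω.H := by
  refine ⟨⟨ω.vec 1, 0, fun h => ?_⟩⟩
  have h1 := ω.inner_vec 1 1
  rw [h] at h1
  simp [ω.map_one] at h1

end States

/-! ### Hilbert space preliminaries -/

section Hilbert

/-- The extension of a surjective isometry to the completions. -/
def completionEquiv {E : Type u} {F : Type v} [SeminormedAddCommGroup E] [NormedSpace ℂ E]
    [SeminormedAddCommGroup F] [NormedSpace ℂ F] (e : E ≃ₗᵢ[ℂ] F) :
    Completion E ≃ₗᵢ[ℂ] Completion F where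
  toFun := (e.toLinearIsometry.toContinuousLinearMap.completion)
  invFun := (e.symm.toLinearIsometry.toContinuousLinearMap.completion)
  map_add' := map_add _
  map_smul' := map_smul _
  left_inv x := by
    induction x using Completion.induction_on with
    | hp => exact isClosed_eq (by fun_prop) (by fun_prop)
    | ih x => simp
  right_inv x := by
    induction x using Completion.induction_on with
    | hp => exact isClosed_eq (by fun_prop) (by fun_prop)
    | ih x => simp
  norm_map' x := by
    change ‖(e.toLinearIsometry.toContinuousLinearMap.completion) x‖ = ‖x‖
    induction x using Completion.induction_on with
    | hp => exact isClosed_eq (by fun_prop) (by fun_prop)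
    | ih x => simp

lemma completionEquiv_coe {E : Type u} {F : Type v} [SeminormedAddCommGroup E] [NormedSpace ℂ E]
    [SeminormedAddCommGroup F] [NormedSpace ℂ F] (e : E ≃ₗᵢ[ℂ] F) (x : E) :
    completionEquiv e (x : Completion E) = (e x : Completion F) :=
  ContinuousLinearMap.completion_apply_coe e.toLinearIsometry.toContinuousLinearMap x

variable {H : Type u} {K : Type v} {H' : Type u} {K' : Type v}
  [NormedAddCommGroup H] [InnerProductSpace ℂ H] [NormedAddCommGroup K] [InnerProductSpace ℂ K]
  [NormedAddCommGroup H'] [InnerProductSpace ℂ H'] [NormedAddCommGroup K'] [InnerProductSpace ℂ K']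

/-- The Hilbert space tensor product: the completion of the algebraic tensor product with respect
to the inner product `⟪x ⊗ y, x' ⊗ y'⟫ = ⟪x, x'⟫ ⟪y, y'⟫`. -/
def HilbertTensor (H : Type u) (K : Type v) [NormedAddCommGroup H] [InnerProductSpace ℂ H]
    [NormedAddCommGroup K] [InnerProductSpace ℂ K] : Type (max u v) :=
  Completion (H ⊗[ℂ] K)

instance : NormedAddCommGroup (HilbertTensor H K) :=
  inferInstanceAs (NormedAddCommGroup (Completion (H ⊗[ℂ] K)))

instance : InnerProductSpace ℂ (HilbertTensor H K) :=
  inferInstanceAs (InnerProductSpace ℂ (Completion (H ⊗[ℂ] K)))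

instance : CompleteSpace (HilbertTensor H K) :=
  inferInstanceAs (CompleteSpace (Completion (H ⊗[ℂ] K)))

/-- The inclusion of the algebraic tensor product. -/
def HilbertTensor.incl : H ⊗[ℂ] K →ₗᵢ[ℂ] HilbertTensor H K :=
  Completion.toComplₗᵢ

lemma HilbertTensor.denseRange_incl :
    DenseRange (HilbertTensor.incl : H ⊗[ℂ] K →ₗᵢ[ℂ] HilbertTensor H K) :=
  Completion.denseRange_coe (α := H ⊗[ℂ] K)

instance [Nontrivial H] [Nontrivial K] : Nontrivial (HilbertTensor H K) := by
  obtain ⟨x, hx⟩ := exists_ne (0 : H)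
  obtain ⟨y, hy⟩ := exists_ne (0 : K)
  refine ⟨⟨HilbertTensor.incl (x ⊗ₜ[ℂ] y), 0, fun h => ?_⟩⟩
  have h1 : ‖HilbertTensor.incl (x ⊗ₜ[ℂ] y)‖ = 0 := by rw [h, norm_zero]
  rw [LinearIsometry.norm_map, TensorProduct.norm_tmul] at h1
  simp [hx, hy] at h1

/-- The bounded operator `S ⊗ T` on the Hilbert space tensor product. -/
def opTensor (S : H →L[ℂ] H) (T : K →L[ℂ] K) : HilbertTensor H K →L[ℂ] HilbertTensor H K :=
  (TensorProduct.mapL S T).completion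

lemma opTensor_incl (S : H →L[ℂ] H) (T : K →L[ℂ] K) (x : H ⊗[ℂ] K) :
    opTensor S T (HilbertTensor.incl x) = HilbertTensor.incl (TensorProduct.mapL S T x) :=
  ContinuousLinearMap.completion_apply_coe (TensorProduct.mapL S T) x

lemma norm_opTensor_le (S : H →L[ℂ] H) (T : K →L[ℂ] K) : ‖opTensor S T‖ ≤ ‖S‖ * ‖T‖ := by
  refine ContinuousLinearMap.opNorm_le_bound _ (by positivity) fun x => ?_
  induction x using HilbertTensor.denseRange_incl.induction_on with
  | hp => exact isClosed_le (by fun_prop) (by fun_prop)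
  | ih x =>
    rw [opTensor_incl, LinearIsometry.norm_map, LinearIsometry.norm_map]
    exact (ContinuousLinearMap.le_opNorm _ _).trans
      (mul_le_mul_of_nonneg_right (TensorProduct.norm_mapL_le S T) (norm_nonneg _))

/-- The unitary `U ⊗ V` between Hilbert space tensor products. -/
def unitaryTensor (U : H ≃ₗᵢ[ℂ] H') (V : K ≃ₗᵢ[ℂ] K') :
    HilbertTensor H K ≃ₗᵢ[ℂ] HilbertTensor H' K' :=
  completionEquiv (TensorProduct.congrIsometry U V)

lemma unitaryTensor_incl (U : H ≃ₗᵢ[ℂ] H') (V : K ≃ₗᵢ[ℂ] K') (x : H ⊗[ℂ] K) :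
    unitaryTensor U V (HilbertTensor.incl x) =
      HilbertTensor.incl (TensorProduct.congrIsometry U V x) :=
  completionEquiv_coe (TensorProduct.congrIsometry U V) x

lemma unitaryTensor_conj [CompleteSpace H] [CompleteSpace K] [CompleteSpace H'] [CompleteSpace K']
    (U : H ≃ₗᵢ[ℂ] H') (V : K ≃ₗᵢ[ℂ] K') (S : H →L[ℂ] H) (T : K →L[ℂ] K) :
    (unitaryTensor U V).conjStarAlgEquiv (opTensor S T) =
      opTensor (U.conjStarAlgEquiv S) (V.conjStarAlgEquiv T) := by
  have key : ∀ z : HilbertTensor H K, unitaryTensor U V (opTensor S T z) =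
      opTensor (U.conjStarAlgEquiv S) (V.conjStarAlgEquiv T) (unitaryTensor U V z) := by
    intro z
    induction z using HilbertTensor.denseRange_incl.induction_on with
    | hp => exact isClosed_eq (by fun_prop) (by fun_prop)
    | ih z =>
      rw [opTensor_incl, unitaryTensor_incl, unitaryTensor_incl, opTensor_incl]
      congr 1
      induction z using TensorProduct.induction_on with
      | zero => simp
      | tmul x y => simp
      | add x y hx hy => simp only [map_add, hx, hy]
  ext z
  rw [LinearIsometryEquiv.conjStarAlgEquiv_apply_apply, key, LinearIsometryEquiv.apply_symm_apply]

/-- The even component of an operator `T` on a Hilbert space graded by a self-adjoint unitary `W`. -/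
def evenOp [CompleteSpace K] (W : K ≃ₗᵢ[ℂ] K) (T : K →L[ℂ] K) : K →L[ℂ] K :=
  (2⁻¹ : ℂ) • (T + W.conjStarAlgEquiv T)

/-- The odd component of an operator `T` on a Hilbert space graded by a self-adjoint unitary `W`. -/
def oddOp [CompleteSpace K] (W : K ≃ₗᵢ[ℂ] K) (T : K →L[ℂ] K) : K →L[ℂ] K :=
  (2⁻¹ : ℂ) • (T - W.conjStarAlgEquiv T)

/-- The Fermi product `S Ⓕ T = S ⊗ T₊ + S V ⊗ T₋` of operators on Hilbert spaces graded by
self-adjoint unitaries `V` and `W`. On `ξ ⊗ η` with `ξ` and `T` homogeneous it equals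
`ε • (S ξ ⊗ T η)`, where `ε = -1` if `T` and `ξ` are both odd and `ε = 1` otherwise. -/
def opFermi [CompleteSpace K] (V : H ≃ₗᵢ[ℂ] H) (W : K ≃ₗᵢ[ℂ] K) (S : H →L[ℂ] H) (T : K →L[ℂ] K) :
    HilbertTensor H K →L[ℂ] HilbertTensor H K :=
  opTensor S (evenOp W T) +
    opTensor (S * V.toLinearIsometry.toContinuousLinearMap) (oddOp W T)

lemma norm_opFermi_le [CompleteSpace K] (V : H ≃ₗᵢ[ℂ] H) (W : K ≃ₗᵢ[ℂ] K) (S : H →L[ℂ] H)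
    (T : K →L[ℂ] K) : ‖opFermi V W S T‖ ≤ 2 * (‖S‖ * ‖T‖) := by
  have hc : ‖W.conjStarAlgEquiv T‖ ≤ ‖T‖ := NonUnitalStarAlgHom.norm_apply_le W.conjStarAlgEquiv T
  have h0 : ‖evenOp W T‖ ≤ ‖T‖ := by
    rw [evenOp, norm_smul, norm_inv, RCLike.norm_ofNat]
    linarith [norm_add_le T (W.conjStarAlgEquiv T)]
  have h1 : ‖oddOp W T‖ ≤ ‖T‖ := by
    rw [oddOp, norm_smul, norm_inv, RCLike.norm_ofNat]
    linarith [norm_sub_le T (W.conjStarAlgEquiv T)]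
  have hV : ‖V.toLinearIsometry.toContinuousLinearMap‖ ≤ 1 :=
    V.toLinearIsometry.norm_toContinuousLinearMap_le
  have hSV : ‖S * V.toLinearIsometry.toContinuousLinearMap‖ ≤ ‖S‖ :=
    (norm_mul_le _ _).trans (mul_le_of_le_one_right (norm_nonneg _) hV)
  have e0 := (norm_opTensor_le S (evenOp W T)).trans
    (mul_le_mul_of_nonneg_left h0 (norm_nonneg S))
  have e1 := (norm_opTensor_le (S * V.toLinearIsometry.toContinuousLinearMap) (oddOp W T)).trans
    (mul_le_mul hSV h1 (norm_nonneg _) (norm_nonneg _))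
  have e2 := norm_add_le (opTensor S (evenOp W T))
    (opTensor (S * V.toLinearIsometry.toContinuousLinearMap) (oddOp W T))
  rw [opFermi]
  linarith

lemma opFermi_conj [CompleteSpace H] [CompleteSpace K] (V : H ≃ₗᵢ[ℂ] H) (W : K ≃ₗᵢ[ℂ] K)
    (S : H →L[ℂ] H) (T : K →L[ℂ] K) :
    (unitaryTensor V W).conjStarAlgEquiv (opFermi V W S T) =
      opFermi V W (V.conjStarAlgEquiv S) (W.conjStarAlgEquiv T) := by
  have hV : V.conjStarAlgEquiv V.toLinearIsometry.toContinuousLinearMap =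
      V.toLinearIsometry.toContinuousLinearMap := by
    ext z
    rw [LinearIsometryEquiv.conjStarAlgEquiv_apply_apply]
    exact congrArg V (V.apply_symm_apply z)
  have h0 : W.conjStarAlgEquiv (evenOp W T) = evenOp W (W.conjStarAlgEquiv T) := by
    rw [evenOp, map_smul, map_add, evenOp]
  have h1 : W.conjStarAlgEquiv (oddOp W T) = oddOp W (W.conjStarAlgEquiv T) := by
    rw [oddOp, map_smul, map_sub, oddOp]
  rw [opFermi, map_add, unitaryTensor_conj, unitaryTensor_conj, map_mul, hV, h0, h1, opFermi]

end Hilbert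

/-! ### Implementation of the grading on GNS spaces -/

section Implement

variable {A : Type u} [CStarAlgebra A] [PartialOrder A] [StarOrderedRing A]

/-- If `g = f ∘ α`, the unitary from the GNS space of `g` to that of `f` which sends the
class of `a` to the class of `α a`. -/
def gnsUnitary (α : Grading A) (f g : State A)
    (h : ∀ a, f.functional (α a) = g.functional a) : g.H ≃ₗᵢ[ℂ] f.H :=
  completionEquiv
    { toFun := fun a => f.functional.toPreGNS (α (g.functional.ofPreGNS a))
      invFun := fun a => g.functional.toPreGNS (α (f.functional.ofPreGNS a))
      map_add' := by simp
      map_smul' := by simp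
      left_inv := fun a => by simp [α.involutive]
      right_inv := fun a => by simp [α.involutive]
      norm_map' := fun a => by
        change ‖f.functional.toPreGNS (α (g.functional.ofPreGNS a))‖ = ‖a‖
        rw [PositiveLinearMap.preGNS_norm_def, PositiveLinearMap.preGNS_norm_def, ← h]
        simp [map_star] }

lemma gnsUnitary_vec (α : Grading A) (f g : State A)
    (h : ∀ a, f.functional (α a) = g.functional a) (a : A) :
    gnsUnitary α f g h (g.vec a) = f.vec (α a) :=
  completionEquiv_coe _ _

lemma gnsUnitary_conj (α : Grading A) (f g : State A)
    (h : ∀ a, f.functional (α a) = g.functional a) (a : A) :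
    (gnsUnitary α f g h).conjStarAlgEquiv (g.rep a) = f.rep (α a) := by
  have key : ∀ z : g.H, gnsUnitary α f g h (g.rep a z) = f.rep (α a) (gnsUnitary α f g h z) := by
    intro z
    induction z using g.denseRange_vec.induction_on with
    | hp => exact isClosed_eq (by fun_prop) (by fun_prop)
    | ih b => rw [gnsUnitary_vec, State.rep_vec, State.rep_vec, gnsUnitary_vec, map_mul]
  ext z
  rw [LinearIsometryEquiv.conjStarAlgEquiv_apply_apply, key, LinearIsometryEquiv.apply_symm_apply]

/-- The self-adjoint unitary `V_ω` on the GNS space of an even state `ω` which implements the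
grading and fixes the cyclic vector. -/
def EvenState.V {α : Grading A} (ω : EvenState α) : ω.H ≃ₗᵢ[ℂ] ω.H :=
  gnsUnitary α ω.toState ω.toState ω.even

end Implement

/-! ### Direct sums of representations

A direct sum of representations on Hilbert spaces `K i` takes values in the block-diagonal operators
on the Hilbert space direct sum of the `K i`, that is, in the C⋆-algebra of bounded families of
operators with the supremum norm. -/

section DirectSum

variable {I : Type u} (K : I → Type v) [∀ i, NormedAddCommGroup (K i)]
  [∀ i, InnerProductSpace ℂ (K i)] [∀ i, CompleteSpace (K i)] [∀ i, Nontrivial (K i)]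

/-- The C⋆-algebra of bounded families of bounded operators. -/
abbrev BlockDiagonal : Type (max u v) := lp (fun i => K i →L[ℂ] K i) ∞

instance : CStarAlgebra (BlockDiagonal K) where

variable {K}

/-- Conjugation of bounded families of operators by unitaries `U i : K (σ i) → K i`. -/
def blockConj (σ : I → I) (U : ∀ i, K (σ i) ≃ₗᵢ[ℂ] K i) :
    BlockDiagonal K →⋆ₐ[ℂ] BlockDiagonal K where
  toFun T := ⟨fun i => (U i).conjStarAlgEquiv (T (σ i)), memℓp_infty ⟨‖T‖, by
    rintro _ ⟨i, rfl⟩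
    refine (NonUnitalStarAlgHom.norm_apply_le ((U i).conjStarAlgEquiv) (T (σ i))).trans ?_
    exact lp.norm_apply_le_norm ENNReal.top_ne_zero T (σ i)⟩⟩
  map_one' := by
    ext1; funext i
    exact map_one (U i).conjStarAlgEquiv
  map_mul' S T := by
    ext1; funext i
    exact map_mul (U i).conjStarAlgEquiv (S (σ i)) (T (σ i))
  map_zero' := by
    ext1; funext i
    exact map_zero (U i).conjStarAlgEquiv
  map_add' S T := by
    ext1; funext i
    exact map_add (U i).conjStarAlgEquiv (S (σ i)) (T (σ i))
  commutes' c := by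
    ext1; funext i
    exact AlgHomClass.commutes (U i).conjStarAlgEquiv c
  map_star' T := by
    ext1; funext i
    exact map_star (U i).conjStarAlgEquiv (T (σ i))

lemma blockConj_apply (σ : I → I) (U : ∀ i, K (σ i) ≃ₗᵢ[ℂ] K i) (T : BlockDiagonal K) (i : I) :
    blockConj σ U T i = (U i).conjStarAlgEquiv (T (σ i)) := rfl

end DirectSum

/-! ### C⋆-algebras given by generators -/

section Generated

variable {C : Type w} [CStarAlgebra C]

/-- The norm closure of the unital ⋆-algebra generated by a subset of a C⋆-algebra. -/
abbrev closedAlgebra (S : Set C) : StarSubalgebra ℂ C :=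
  (StarAlgebra.adjoin ℂ S).topologicalClosure

instance (S : Set C) : CStarAlgebra (closedAlgebra S) :=
  StarSubalgebra.cstarAlgebra _ (h_closed := StarSubalgebra.isClosed_topologicalClosure _)

lemma continuous_starAlgHom (Θ : C →⋆ₐ[ℂ] C) : Continuous Θ :=
  AddMonoidHomClass.continuous_of_bound Θ 1 fun x => by
    simpa using NonUnitalStarAlgHom.norm_apply_le Θ x

lemma mem_closedAlgebra {S : Set C} {x : C} (hx : x ∈ S) : x ∈ closedAlgebra S :=
  StarSubalgebra.le_topologicalClosure _ (StarAlgebra.subset_adjoin ℂ S hx)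

lemma map_mem_closedAlgebra {S : Set C} (Θ : C →⋆ₐ[ℂ] C) (hS : ∀ x ∈ S, Θ x ∈ S)
    (x : closedAlgebra S) : Θ x ∈ closedAlgebra S := by
  have h1 : closedAlgebra S ≤ (closedAlgebra S).comap Θ := by
    refine StarSubalgebra.topologicalClosure_minimal (StarAlgebra.adjoin_le fun y hy => ?_) ?_
    · exact mem_closedAlgebra (hS y hy)
    · exact (StarSubalgebra.isClosed_topologicalClosure _).preimage (continuous_starAlgHom Θ)
  exact h1 x.2

/-- The closed ⋆-algebra generated by the elements `G a b`. -/
abbrev tensorAlgebra {A : Type u} {B : Type v} (G : A → B → C) : StarSubalgebra ℂ C :=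
  closedAlgebra {x | ∃ a b, G a b = x}

/-- The elements `G a b` in the algebra which they generate. -/
def tensorGen {A : Type u} {B : Type v} (G : A → B → C) (a : A) (b : B) : tensorAlgebra G :=
  ⟨G a b, mem_closedAlgebra ⟨a, b, rfl⟩⟩

/-- The restriction to `tensorAlgebra G` of a ⋆-homomorphism with `G a b ↦ G (α a) (β b)`. -/
def tensorGrading {A : Type u} [CStarAlgebra A] {B : Type v} [CStarAlgebra B] (G : A → B → C)
    (α : Grading A) (β : Grading B) (Θ : C →⋆ₐ[ℂ] C)
    (hΘ : ∀ a b, Θ (G a b) = G (α a) (β b)) : Grading (tensorAlgebra G) where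
  toHom := (Θ.comp (tensorAlgebra G).subtype).codRestrict (tensorAlgebra G)
    (map_mem_closedAlgebra Θ (by
      rintro _ ⟨a, b, rfl⟩
      exact ⟨_, _, (hΘ a b).symm⟩))
  involutive x := by
    have h1 : tensorAlgebra G ≤ StarAlgHom.equalizer (Θ.comp Θ) (StarAlgHom.id ℂ C) := by
      refine StarSubalgebra.topologicalClosure_minimal (StarAlgebra.adjoin_le fun y hy => ?_) ?_
      · obtain ⟨a, b, rfl⟩ := hy
        change Θ (Θ (G a b)) = G a b
        rw [hΘ, hΘ, α.involutive, β.involutive]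
      · exact isClosed_eq (continuous_starAlgHom (Θ.comp Θ)) continuous_id
    exact Subtype.ext (h1 x.2)

lemma tensorGrading_gen {A : Type u} [CStarAlgebra A] {B : Type v} [CStarAlgebra B] (G : A → B → C)
    (α : Grading A) (β : Grading B) (Θ : C →⋆ₐ[ℂ] C)
    (hΘ : ∀ a b, Θ (G a b) = G (α a) (β b)) (a : A) (b : B) :
    tensorGrading G α β Θ hΘ (tensorGen G a b) = tensorGen G (α a) (β b) :=
  Subtype.ext (hΘ a b)

end Generated

/-! ### The tensor products -/

section Tensor

variable {A : Type u} [CStarAlgebra A] [PartialOrder A] [StarOrderedRing A]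
  {B : Type v} [CStarAlgebra B] [PartialOrder B] [StarOrderedRing B]

/-! #### The Fermi tensor product -/

section Fermi

variable (α : Grading A) (β : Grading B)

/-- The Fermi product `π_ω(a) Ⓕ π_φ(b)` of the GNS representations of two even states, acting on
`H_ω ⊗ H_φ`. -/
def fermiRep (p : EvenState α × EvenState β) (a : A) (b : B) :
    HilbertTensor p.1.H p.2.H →L[ℂ] HilbertTensor p.1.H p.2.H :=
  opFermi p.1.V p.2.V (p.1.rep a) (p.2.rep b)

lemma norm_fermiRep_le (p : EvenState α × EvenState β) (a : A) (b : B) :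
    ‖fermiRep α β p a b‖ ≤ 2 * (‖a‖ * ‖b‖) := by
  refine (norm_opFermi_le _ _ _ _).trans ?_
  gcongr
  · exact NonUnitalStarAlgHom.norm_apply_le p.1.rep a
  · exact NonUnitalStarAlgHom.norm_apply_le p.2.rep b

lemma fermiRep_conj (p : EvenState α × EvenState β) (a : A) (b : B) :
    (unitaryTensor p.1.V p.2.V).conjStarAlgEquiv (fermiRep α β p a b) =
      fermiRep α β p (α a) (β b) := by
  refine (opFermi_conj _ _ _ _).trans ?_
  rw [fermiRep, ← gnsUnitary_conj α p.1.toState p.1.toState p.1.even,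
    ← gnsUnitary_conj β p.2.toState p.2.toState p.2.even]
  rfl

/-- The image of `a Ⓕ b` in the direct sum of the representations `π_ω Ⓕ π_φ` over all pairs of
even states. -/
def fermiGen (a : A) (b : B) :
    BlockDiagonal (fun p : EvenState α × EvenState β => HilbertTensor p.1.H p.2.H) :=
  ⟨fun p => fermiRep α β p a b, memℓp_infty ⟨_, by
    rintro _ ⟨p, rfl⟩
    exact norm_fermiRep_le α β p a b⟩⟩

/-- The Fermi C⋆-tensor product `A Ⓕ B` with its minimal C⋆-norm, that is, the norm given by the
direct sum of the GNS representations of all products of even states. -/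
abbrev FermiTensor : Type (max u v) := tensorAlgebra (fermiGen α β)

/-- The elementary tensor `a Ⓕ b`. -/
def fermiTmul (a : A) (b : B) : FermiTensor α β :=
  tensorGen (fermiGen α β) a b

/-- Conjugation by the direct sum of the unitaries `V_ω ⊗ V_φ`. -/
def fermiConj :
    BlockDiagonal (fun p : EvenState α × EvenState β => HilbertTensor p.1.H p.2.H) →⋆ₐ[ℂ]
      BlockDiagonal (fun p : EvenState α × EvenState β => HilbertTensor p.1.H p.2.H) :=
  blockConj id fun p => unitaryTensor p.1.V p.2.V

lemma fermiConj_fermiGen (a : A) (b : B) :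
    fermiConj α β (fermiGen α β a b) = fermiGen α β (α a) (β b) := by
  ext1; funext p
  exact fermiRep_conj α β p a b

/-- The grading `α Ⓕ β`. -/
def fermiGrading : Grading (FermiTensor α β) :=
  tensorGrading (fermiGen α β) α β (fermiConj α β) (fermiConj_fermiGen α β)

lemma fermiGrading_tmul (a : A) (b : B) :
    fermiGrading α β (fermiTmul α β a b) = fermiTmul α β (α a) (β b) :=
  tensorGrading_gen _ _ _ _ (fermiConj_fermiGen α β) a b

end Fermi

/-! #### The usual tensor product -/

section Usual

/-- The product `π_ω(a) ⊗ π_φ(b)` of the GNS representations of two states. -/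
def prodRep (p : State A × State B) (a : A) (b : B) :
    HilbertTensor p.1.H p.2.H →L[ℂ] HilbertTensor p.1.H p.2.H :=
  opTensor (p.1.rep a) (p.2.rep b)

lemma norm_prodRep_le (p : State A × State B) (a : A) (b : B) :
    ‖prodRep p a b‖ ≤ ‖a‖ * ‖b‖ := by
  refine (norm_opTensor_le _ _).trans ?_
  gcongr
  · exact NonUnitalStarAlgHom.norm_apply_le p.1.rep a
  · exact NonUnitalStarAlgHom.norm_apply_le p.2.rep b

/-- The image of `a ⊗ b` in the tensor product of the universal representations of `A` and `B`. -/
def prodGen (a : A) (b : B) :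
    BlockDiagonal (fun p : State A × State B => HilbertTensor p.1.H p.2.H) :=
  ⟨fun p => prodRep p a b, memℓp_infty ⟨_, by
    rintro _ ⟨p, rfl⟩
    exact norm_prodRep_le p a b⟩⟩

variable (A B)

/-- The C⋆-tensor product of `A` and `B` with the minimal (spatial) C⋆-norm, that is, the norm given
by the tensor product of the universal representations. -/
abbrev MinTensor : Type (max u v) := tensorAlgebra (prodGen (A := A) (B := B))

variable {A B}

/-- The elementary tensor `a ⊗ b`. -/
def minTmul (a : A) (b : B) : MinTensor A B :=
  tensorGen prodGen a b

variable (α : Grading A) (β : Grading B)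

/-- The identification of the blocks `(ω ∘ α, φ ∘ β)` and `(ω, φ)`. -/
def prodConj :
    BlockDiagonal (fun p : State A × State B => HilbertTensor p.1.H p.2.H) →⋆ₐ[ℂ]
      BlockDiagonal (fun p : State A × State B => HilbertTensor p.1.H p.2.H) :=
  blockConj (fun p => (p.1.comp α, p.2.comp β)) fun p =>
    unitaryTensor (gnsUnitary α p.1 (p.1.comp α) (p.1.comp_apply α · |>.symm))
      (gnsUnitary β p.2 (p.2.comp β) (p.2.comp_apply β · |>.symm))

lemma prodConj_prodGen (a : A) (b : B) :
    prodConj α β (prodGen a b) = prodGen (α a) (β b) := by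
  ext1; funext p
  refine (unitaryTensor_conj _ _ ((p.1.comp α).rep a) ((p.2.comp β).rep b)).trans ?_
  exact congrArg₂ opTensor (gnsUnitary_conj α p.1 (p.1.comp α) (p.1.comp_apply α · |>.symm) a)
    (gnsUnitary_conj β p.2 (p.2.comp β) (p.2.comp_apply β · |>.symm) b)

/-- The grading `α ⊗ β`. -/
def minGrading : Grading (MinTensor A B) :=
  tensorGrading prodGen α β (prodConj α β) (prodConj_prodGen α β)

lemma minGrading_tmul (a : A) (b : B) :
    minGrading α β (minTmul a b) = minTmul (α a) (β b) :=
  tensorGrading_gen _ _ _ _ (prodConj_prodGen α β) a b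

end Usual

end Tensor

end FermiKlein
end

noncomputable section

namespace FermiKlein

/-! ### Operators on Hilbert space tensor products -/

section Hilbert

variable {H : Type u} {K : Type v} {H' : Type u} {K' : Type v}
  [NormedAddCommGroup H] [InnerProductSpace ℂ H] [NormedAddCommGroup K] [InnerProductSpace ℂ K]
  [NormedAddCommGroup H'] [InnerProductSpace ℂ H'] [NormedAddCommGroup K'] [InnerProductSpace ℂ K']

/-! On the GNS space of an even state `ω` of `A`, both the grading unitary `V` and `π(u)` implement
`α`. Their product `Z = V π(u)` therefore implements `α² = id`: it is a self-adjoint unitary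
commuting with `π(A)`. Let `W` be the grading unitary of an even state of `B` and let `P± = (1 ±
Z)/2`. The Klein unitary `P₊ ⊗ 1 + P₋ ⊗ W` commutes with `π(a) ⊗ T` when `T` is even; when `T` is
odd, the sign from `W T = -T W` turns `π(a) ⊗ T` into `π(a) Z ⊗ T` under conjugation. Since `π(a) Z
= π(au) V`, and the `V` here is exactly the twist in the Fermi product with an odd element,
conjugation carries the block of `a ⊗ b` to the Fermi block of `a` with `b₊` plus that of `au` with
`b₋` (`kleinUnitary_mul_prodRep`).

Assembled over all pairs of even states, this gives `kleinHom`, defined on the block-diagonal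
operators of all pairs of states. It discards the blocks that are not even, so injectivity on the
minimal tensor product needs an argument. Every state satisfies `ω ≤ 2ω'` with `ω' = (ω + ω ∘ α)/2`
even, so the identity of `A` induces a bounded map of GNS spaces from `ω'` to `ω` that intertwines
the representations. Tensoring two such maps shows that an element with vanishing even blocks
vanishes (`minTensor_eq_zero`).

As `u² = 1`, the elements `a ⊗ b₊ + au ⊗ b₋` are sent to the Fermi generators (`kleinHom_klein`).
Hence `kleinHom` restricts to an isomorphism of the minimal onto the Fermi tensor product, and `κ`
is its inverse. Compatibility with the gradings is checked on generators, using `α(u) = u`. -/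

lemma HilbertTensor.continuous_incl_tmul :
    Continuous fun z : H × K => HilbertTensor.incl (z.1 ⊗ₜ[ℂ] z.2) :=
  HilbertTensor.incl.continuous.comp TensorProduct.continuous_tmul

/-- Elementary tensors depend jointly continuously on their factors, so agreement passes from dense
families to all of them, then by linearity and density to the whole space. The dense families used
later are the GNS classes. -/
lemma HilbertTensor.ext_of_denseRange {ι κ E : Type*} [NormedAddCommGroup E] [NormedSpace ℂ E]
    {X Y : HilbertTensor H K →L[ℂ] E} {f : ι → H} {g : κ → K} (hf : DenseRange f)
    (hg : DenseRange g)
    (h : ∀ i j, X (HilbertTensor.incl (f i ⊗ₜ g j)) = Y (HilbertTensor.incl (f i ⊗ₜ g j))) :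
    X = Y := by
  have h2 : ∀ z : H × K, X (HilbertTensor.incl (z.1 ⊗ₜ[ℂ] z.2)) =
      Y (HilbertTensor.incl (z.1 ⊗ₜ[ℂ] z.2)) := fun z =>
    congrFun ((hf.prodMap hg).equalizer (X.continuous.comp continuous_incl_tmul)
      (Y.continuous.comp continuous_incl_tmul) (funext fun i => h i.1 i.2)) z
  ext z
  induction z using HilbertTensor.denseRange_incl.induction_on with
  | hp => exact isClosed_eq (by fun_prop) (by fun_prop)
  | ih z =>
    induction z using TensorProduct.induction_on with
    | zero => simp
    | tmul x y => exact h2 (x, y)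
    | add x y hx hy => simp only [map_add, hx, hy]

lemma HilbertTensor.ext {E : Type*} [NormedAddCommGroup E] [NormedSpace ℂ E]
    {X Y : HilbertTensor H K →L[ℂ] E}
    (h : ∀ x y, X (HilbertTensor.incl (x ⊗ₜ y)) = Y (HilbertTensor.incl (x ⊗ₜ y))) : X = Y :=
  ext_of_denseRange denseRange_id denseRange_id h

lemma opTensor_incl_tmul (S : H →L[ℂ] H) (T : K →L[ℂ] K) (x : H) (y : K) :
    opTensor S T (HilbertTensor.incl (x ⊗ₜ y)) = HilbertTensor.incl (S x ⊗ₜ T y) :=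
  opTensor_incl S T _

lemma opTensor_one : opTensor (1 : H →L[ℂ] H) (1 : K →L[ℂ] K) = 1 :=
  HilbertTensor.ext fun x y => by simp [opTensor_incl_tmul]

lemma opTensor_mul (S S' : H →L[ℂ] H) (T T' : K →L[ℂ] K) :
    opTensor S T * opTensor S' T' = opTensor (S * S') (T * T') :=
  HilbertTensor.ext fun x y => by simp [opTensor_incl_tmul]

lemma opTensor_add_right (S : H →L[ℂ] H) (T T' : K →L[ℂ] K) :
    opTensor S (T + T') = opTensor S T + opTensor S T' :=
  HilbertTensor.ext fun x y => by simp [opTensor_incl_tmul, TensorProduct.tmul_add]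

lemma opTensor_smul_right (c : ℂ) (S : H →L[ℂ] H) (T : K →L[ℂ] K) :
    opTensor S (c • T) = c • opTensor S T :=
  HilbertTensor.ext fun x y => by simp [opTensor_incl_tmul]

lemma opTensor_neg_right (S : H →L[ℂ] H) (T : K →L[ℂ] K) :
    opTensor S (-T) = -opTensor S T :=
  HilbertTensor.ext fun x y => by simp [opTensor_incl_tmul, TensorProduct.tmul_neg]

lemma star_opTensor [CompleteSpace H] [CompleteSpace K] (S : H →L[ℂ] H) (T : K →L[ℂ] K) :
    star (opTensor S T) = opTensor (star S) (star T) := by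
  symm
  refine (ContinuousLinearMap.eq_adjoint_iff _ _).mpr fun z z' => ?_
  induction z using HilbertTensor.denseRange_incl.induction_on with
  | hp => exact isClosed_eq (by fun_prop) (by fun_prop)
  | ih z =>
  induction z' using HilbertTensor.denseRange_incl.induction_on with
  | hp => exact isClosed_eq (by fun_prop) (by fun_prop)
  | ih z' =>
  rw [opTensor_incl, opTensor_incl, LinearIsometry.inner_map_map, LinearIsometry.inner_map_map]
  induction z using TensorProduct.induction_on with
  | zero => simp
  | add x y hx hy => simp only [map_add, inner_add_left, hx, hy]
  | tmul x y =>
  induction z' using TensorProduct.induction_on with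
  | zero => simp
  | add x y hx hy => simp only [map_add, inner_add_right, hx, hy]
  | tmul x' y' =>
  simp [ContinuousLinearMap.star_eq_adjoint, ContinuousLinearMap.adjoint_inner_left]

/-- The bounded operator `S ⊗ T` between Hilbert space tensor products. -/
def mapTensor (S : H →L[ℂ] H') (T : K →L[ℂ] K') : HilbertTensor H K →L[ℂ] HilbertTensor H' K' :=
  (TensorProduct.mapL S T).completion

lemma mapTensor_incl_tmul (S : H →L[ℂ] H') (T : K →L[ℂ] K') (x : H) (y : K) :
    mapTensor S T (HilbertTensor.incl (x ⊗ₜ y)) = HilbertTensor.incl (S x ⊗ₜ T y) :=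
  ContinuousLinearMap.completion_apply_coe (TensorProduct.mapL S T) _

end Hilbert

/-! ### The Klein transformation of operators -/

section Klein

variable {H : Type u} {K : Type v}
  [NormedAddCommGroup H] [InnerProductSpace ℂ H] [NormedAddCommGroup K] [InnerProductSpace ℂ K]

/-- The Klein transformation `(1 + Z ⊗ 1 + 1 ⊗ W - Z ⊗ W) / 2`, which is `1` on the even and
`1 ⊗ W` on the odd eigenspace of `Z ⊗ 1`. -/
def kleinOp (Z : H →L[ℂ] H) (W : K →L[ℂ] K) : HilbertTensor H K →L[ℂ] HilbertTensor H K :=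
  (2⁻¹ : ℂ) • (1 + opTensor Z 1 + opTensor 1 W - opTensor Z W)

/-- The operator equals `P₊ ⊗ 1 + P₋ ⊗ W` with complementary idempotents `P± = (1 ± Z)/2`, and both
`1` and `W` square to `1`. -/
lemma kleinOp_mul_self {Z : H →L[ℂ] H} {W : K →L[ℂ] K} (hZ : Z * Z = 1) (hW : W * W = 1) :
    kleinOp Z W * kleinOp Z W = 1 := by
  simp only [kleinOp, smul_mul_smul_comm, mul_add, add_mul, mul_sub, sub_mul, opTensor_mul,
    one_mul, mul_one, hZ, hW, opTensor_one]
  module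

lemma star_kleinOp [CompleteSpace H] [CompleteSpace K] {Z : H →L[ℂ] H} {W : K →L[ℂ] K}
    (hZ : star Z = Z) (hW : star W = W) : star (kleinOp Z W) = kleinOp Z W := by
  simp [kleinOp, star_opTensor, hZ, hW]

lemma kleinOp_mem_unitary [CompleteSpace H] [CompleteSpace K] {Z : H →L[ℂ] H} {W : K →L[ℂ] K}
    (hZ : Z * Z = 1) (hW : W * W = 1) (hZs : star Z = Z) (hWs : star W = W) :
    kleinOp Z W ∈ unitary (HilbertTensor H K →L[ℂ] HilbertTensor H K) := by
  rw [Unitary.mem_iff, star_kleinOp hZs hWs, kleinOp_mul_self hZ hW]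
  exact ⟨rfl, rfl⟩

lemma kleinOp_commute_opTensor_even {Z S : H →L[ℂ] H} {W T : K →L[ℂ] K}
    (hZ : Z * S = S * Z) (hW : W * T = T * W) :
    kleinOp Z W * opTensor S T = opTensor S T * kleinOp Z W := by
  simp only [kleinOp, smul_mul_assoc, mul_smul_comm, mul_add, add_mul, mul_sub, sub_mul,
    opTensor_mul, one_mul, mul_one, hZ, hW]

/-- Moving `T` past `W` costs a sign on the `-1` eigenspace of `Z` and nothing on the `+1`
eigenspace; that sign is multiplication by `Z`. -/
lemma kleinOp_mul_opTensor_odd {Z S : H →L[ℂ] H} {W T : K →L[ℂ] K} (hZZ : Z * Z = 1)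
    (hZ : Z * S = S * Z) (hW : W * T = -(T * W)) :
    kleinOp Z W * opTensor S T = opTensor (S * Z) T * kleinOp Z W := by
  have h : S * Z * Z = S := by rw [mul_assoc, hZZ, mul_one]
  simp only [kleinOp, smul_mul_assoc, mul_smul_comm, mul_add, add_mul, mul_sub, sub_mul,
    opTensor_mul, one_mul, mul_one, hZ, hW, h, opTensor_neg_right]
  module

end Klein

/-! ### Even and odd components -/

section Grading

variable {A : Type u} [CStarAlgebra A]

lemma Grading.map_even (α : Grading A) (a : A) : α (α.even a) = α.even a := by
  simp only [Grading.even, map_smul, map_add, α.involutive, add_comm]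

lemma Grading.map_odd (α : Grading A) (a : A) : α (α.odd a) = -α.odd a := by
  simp only [Grading.odd, map_smul, map_sub, α.involutive, ← smul_neg, neg_sub]

lemma Grading.even_map (α : Grading A) (a : A) : α.even (α a) = α.even a := by
  simp only [Grading.even, α.involutive, add_comm]

lemma Grading.odd_map (α : Grading A) (a : A) : α.odd (α a) = -α.odd a := by
  simp only [Grading.odd, α.involutive, ← smul_neg, neg_sub]

lemma Grading.even_add_odd (α : Grading A) (a : A) : α.even a + α.odd a = a := by
  simp only [Grading.even, Grading.odd]
  module

lemma Grading.even_even (α : Grading A) (a : A) : α.even (α.even a) = α.even a := by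
  conv_lhs => rw [Grading.even, α.map_even]
  module

lemma Grading.even_odd (α : Grading A) (a : A) : α.even (α.odd a) = 0 := by
  rw [Grading.even, α.map_odd, add_neg_cancel, smul_zero]

lemma Grading.odd_even (α : Grading A) (a : A) : α.odd (α.even a) = 0 := by
  rw [Grading.odd, α.map_even, sub_self, smul_zero]

lemma Grading.odd_odd (α : Grading A) (a : A) : α.odd (α.odd a) = α.odd a := by
  conv_lhs => rw [Grading.odd, α.map_odd]
  module

end Grading

/-! ### States -/

section States

variable {A : Type u} [CStarAlgebra A] [PartialOrder A] [StarOrderedRing A]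

/-- If `f ≤ 2 g`, the bounded operator from the GNS space of `g` to that of `f` which sends the
class of `a` to the class of `a`. -/
def gnsMap (f g : State A)
    (h : ∀ a, (f.functional (star a * a)).re ≤ 2 * (g.functional (star a * a)).re) :
    g.H →L[ℂ] f.H :=
  -- GNS norms are square roots of values at `star a * a`, so the factor `2` in `h` becomes `√2`.
  ((f.functional.toPreGNS.toLinearMap ∘ₗ g.functional.ofPreGNS.toLinearMap).mkContinuous (√2)
    fun a => by
      rw [PositiveLinearMap.preGNS_norm_def, PositiveLinearMap.preGNS_norm_def,
        ← Real.sqrt_mul (by norm_num)]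
      exact Real.sqrt_le_sqrt (h _)).completion

lemma gnsMap_vec (f g : State A)
    (h : ∀ a, (f.functional (star a * a)).re ≤ 2 * (g.functional (star a * a)).re) (a : A) :
    gnsMap f g h (g.vec a) = f.vec a :=
  ContinuousLinearMap.completion_apply_coe _ _

/-- The even state `(ω + ω ∘ α) / 2`. -/
def State.symmetrize (ω : State A) (α : Grading A) : EvenState α where
  functional := PositiveLinearMap.mk₀
    ((2⁻¹ : ℂ) • (ω.functional.toLinearMap + (ω.comp α).functional.toLinearMap)) fun a ha => by
      have h : (0 : ℂ) ≤ 2⁻¹ := by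
        simp
      exact mul_nonneg h (add_nonneg (ω.functional.map_nonneg ha)
        ((ω.comp α).functional.map_nonneg ha))
  map_one := by
    change (2⁻¹ : ℂ) * (ω.functional 1 + (ω.comp α).functional 1) = 1
    rw [ω.map_one, (ω.comp α).map_one]
    norm_num
  even a := by
    change (2⁻¹ : ℂ) * (ω.functional (α a) + ω.functional (α (α a))) =
      (2⁻¹ : ℂ) * (ω.functional a + ω.functional (α a))
    rw [α.involutive, add_comm]

lemma State.symmetrize_apply (ω : State A) (α : Grading A) (a : A) :
    (ω.symmetrize α).functional a = 2⁻¹ * (ω.functional a + ω.functional (α a)) := rfl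

/-- Twice the symmetrized state exceeds `ω` by `ω ∘ α`, which is positive. This is the domination
required by `gnsMap`. -/
lemma State.le_two_symmetrize (ω : State A) (α : Grading A) (a : A) :
    (ω.functional (star a * a)).re ≤ 2 * ((ω.symmetrize α).functional (star a * a)).re := by
  have h : 0 ≤ ω.functional (α (star a * a)) :=
    (ω.comp α).functional.map_nonneg (star_mul_self_nonneg a)
  have h' := (Complex.le_def.1 h).1
  have e : 2 * (ω.symmetrize α).functional (star a * a) =
      ω.functional (star a * a) + ω.functional (α (star a * a)) := by
    rw [State.symmetrize_apply]; ring
  have e' := congrArg Complex.re e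
  simp only [Complex.add_re, Complex.mul_re, Complex.re_ofNat, Complex.im_ofNat, zero_mul,
    sub_zero, Complex.zero_re] at e' h'
  linarith

variable {α : Grading A}

/-- The grading unitary of an even state as an operator. -/
def EvenState.VOp (ω : EvenState α) : ω.H →L[ℂ] ω.H := ω.V.toLinearIsometry.toContinuousLinearMap

lemma EvenState.VOp_vec (ω : EvenState α) (a : A) : ω.VOp (ω.vec a) = ω.vec (α a) :=
  gnsUnitary_vec α ω.toState ω.toState ω.even a

lemma State.ext_vec {E : Type*} [NormedAddCommGroup E] [NormedSpace ℂ E] (ω : State A)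
    {X Y : ω.H →L[ℂ] E} (h : ∀ a, X (ω.vec a) = Y (ω.vec a)) : X = Y :=
  ContinuousLinearMap.coeFn_injective
    (ω.denseRange_vec.equalizer X.continuous Y.continuous (funext h))

lemma EvenState.VOp_mul_self (ω : EvenState α) : ω.VOp * ω.VOp = 1 :=
  ω.ext_vec fun a => by
    rw [mul_apply_eq_comp, VOp_vec, VOp_vec, α.involutive]; rfl

lemma EvenState.VOp_mul_rep (ω : EvenState α) (a : A) :
    ω.VOp * ω.rep a = ω.rep (α a) * ω.VOp :=
  ω.ext_vec fun b => by
    rw [mul_apply_eq_comp, mul_apply_eq_comp, State.rep_vec, VOp_vec,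
      VOp_vec, State.rep_vec, map_mul]

/-- An isometry has its adjoint as left inverse, and an involution is its own inverse. -/
lemma EvenState.star_VOp (ω : EvenState α) : star ω.VOp = ω.VOp := by
  have h : star ω.VOp * ω.VOp = 1 := by
    refine (ContinuousLinearMap.inner_map_map_iff_adjoint_comp_self _).1 fun x y => ?_
    exact ω.V.inner_map_map x y
  calc star ω.VOp = star ω.VOp * (ω.VOp * ω.VOp) := by rw [VOp_mul_self, mul_one]
    _ = ω.VOp := by rw [← mul_assoc, h, one_mul]

/-- Conjugation by `ω.V` implements `α` in the representation, so the components of operators match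
those of the algebra. -/
lemma EvenState.evenOp_rep (ω : EvenState α) (a : A) :
    evenOp ω.V (ω.rep a) = ω.rep (α.even a) := by
  have := gnsUnitary_conj α ω.toState ω.toState ω.even a
  rw [evenOp, EvenState.V, this, Grading.even, map_smul, map_add]

lemma EvenState.oddOp_rep (ω : EvenState α) (a : A) :
    oddOp ω.V (ω.rep a) = ω.rep (α.odd a) := by
  have := gnsUnitary_conj α ω.toState ω.toState ω.even a
  rw [oddOp, EvenState.V, this, Grading.odd, map_smul, map_sub]

end States

/-! ### Block-diagonal operators -/

section Block

variable {I : Type u} (K : I → Type v) [∀ i, NormedAddCommGroup (K i)]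
  [∀ i, InnerProductSpace ℂ (K i)] [∀ i, CompleteSpace (K i)] [∀ i, Nontrivial (K i)]

/-- The evaluation of a bounded family of operators at an index. -/
def blockEval (i : I) : BlockDiagonal K →⋆ₐ[ℂ] (K i →L[ℂ] K i) where
  toFun T := T i
  map_one' := rfl
  map_mul' _ _ := rfl
  map_zero' := rfl
  map_add' _ _ := rfl
  commutes' _ := rfl
  map_star' _ := rfl

variable {K} in
/-- The direct sum of a family of representations. -/
def blockLift {C : Type w} [CStarAlgebra C] (π : ∀ i, C →⋆ₐ[ℂ] (K i →L[ℂ] K i)) :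
    C →⋆ₐ[ℂ] BlockDiagonal K where
  toFun x := ⟨fun i => π i x, memℓp_infty ⟨‖x‖, by
    rintro _ ⟨i, rfl⟩
    exact NonUnitalStarAlgHom.norm_apply_le (π i) x⟩⟩
  map_one' := by
    ext1; funext i
    exact map_one (π i)
  map_mul' x y := by
    ext1; funext i
    exact map_mul (π i) x y
  map_zero' := by
    ext1; funext i
    exact map_zero (π i)
  map_add' x y := by
    ext1; funext i
    exact map_add (π i) x y
  commutes' c := by
    ext1; funext i
    exact AlgHomClass.commutes (π i) c
  map_star' x := by
    ext1; funext i
    exact map_star (π i) x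

end Block

/-! ### Elements whose representations are intertwined by a bounded operator -/

section Intertwine

variable {C : Type w} [CStarAlgebra C] {H : Type u} {K : Type v} [NormedAddCommGroup H]
  [InnerProductSpace ℂ H] [CompleteSpace H] [NormedAddCommGroup K] [InnerProductSpace ℂ K]
  [CompleteSpace K]

/-- The elements `x` such that `T` intertwines `π x` with `ρ x` and `π (star x)` with
`ρ (star x)`. -/
def intertwined (π : C →⋆ₐ[ℂ] (H →L[ℂ] H)) (ρ : C →⋆ₐ[ℂ] (K →L[ℂ] K)) (T : H →L[ℂ] K) :
    StarSubalgebra ℂ C where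
  carrier := {x | (ρ x).comp T = T.comp (π x) ∧ (ρ (star x)).comp T = T.comp (π (star x))}
  mul_mem' {x y} hx hy := by
    have key : ∀ x y : C, (ρ x).comp T = T.comp (π x) → (ρ y).comp T = T.comp (π y) →
        (ρ (x * y)).comp T = T.comp (π (x * y)) := fun x y hx hy => by
      rw [map_mul, map_mul, ContinuousLinearMap.mul_def, ContinuousLinearMap.mul_def,
        ContinuousLinearMap.comp_assoc, hy, ← ContinuousLinearMap.comp_assoc, hx,
        ContinuousLinearMap.comp_assoc]
    refine ⟨key x y hx.1 hy.1, ?_⟩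
    rw [star_mul]
    exact key _ _ hy.2 hx.2
  add_mem' {x y} hx hy := by
    refine ⟨?_, ?_⟩
    · simp only [map_add, ContinuousLinearMap.add_comp, ContinuousLinearMap.comp_add, hx.1, hy.1]
    · simp only [star_add, map_add, ContinuousLinearMap.add_comp, ContinuousLinearMap.comp_add,
        hx.2, hy.2]
  algebraMap_mem' c := by
    have key : ∀ c : ℂ, (ρ (algebraMap ℂ C c)).comp T = T.comp (π (algebraMap ℂ C c)) := fun c => by
      ext x
      simp [Algebra.algebraMap_eq_smul_one]
    refine ⟨key c, ?_⟩
    rw [← algebraMap_star_comm]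
    exact key _
  star_mem' {x} hx := ⟨hx.2, by rw [star_star]; exact hx.1⟩

lemma continuous_rep (π : C →⋆ₐ[ℂ] (H →L[ℂ] H)) : Continuous π :=
  AddMonoidHomClass.continuous_of_bound π 1 fun x => by
    simpa using NonUnitalStarAlgHom.norm_apply_le π x

lemma isClosed_intertwined (π : C →⋆ₐ[ℂ] (H →L[ℂ] H)) (ρ : C →⋆ₐ[ℂ] (K →L[ℂ] K)) (T : H →L[ℂ] K) :
    IsClosed (intertwined π ρ T : Set C) := by
  have key : IsClosed {x : C | (ρ x).comp T = T.comp (π x)} :=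
    isClosed_eq ((continuous_rep ρ).clm_comp continuous_const)
      (continuous_const.clm_comp (continuous_rep π))
  exact key.inter (key.preimage continuous_star)

end Intertwine

/-! ### Comparison of the blocks of the minimal tensor product -/

section Min

variable {A : Type u} [CStarAlgebra A] [PartialOrder A] [StarOrderedRing A]
  {B : Type v} [CStarAlgebra B] [PartialOrder B] [StarOrderedRing B]

/-- The operator from the symmetrized block `(ω', φ')` to the block `(ω, φ)` which sends the class
of `a ⊗ b` to the class of `a ⊗ b`. -/
def symmetrizeMap (α : Grading A) (β : Grading B) (p : State A × State B) :
    HilbertTensor (p.1.symmetrize α).H (p.2.symmetrize β).H →L[ℂ] HilbertTensor p.1.H p.2.H :=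
  mapTensor (gnsMap _ _ (p.1.le_two_symmetrize α)) (gnsMap _ _ (p.2.le_two_symmetrize β))

lemma symmetrizeMap_vec (α : Grading A) (β : Grading B) (p : State A × State B) (a : A) (b : B) :
    symmetrizeMap α β p (HilbertTensor.incl
      ((p.1.symmetrize α).vec a ⊗ₜ (p.2.symmetrize β).vec b)) =
      HilbertTensor.incl (p.1.vec a ⊗ₜ p.2.vec b) := by
  rw [symmetrizeMap, mapTensor_incl_tmul, gnsMap_vec, gnsMap_vec]

lemma prodRep_vec (p : State A × State B) (a c : A) (b d : B) :
    prodRep p a b (HilbertTensor.incl (p.1.vec c ⊗ₜ p.2.vec d)) =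
      HilbertTensor.incl (p.1.vec (a * c) ⊗ₜ p.2.vec (b * d)) := by
  rw [prodRep, opTensor_incl_tmul, State.rep_vec, State.rep_vec]

lemma star_prodGen (a : A) (b : B) : star (prodGen a b) = prodGen (star a) (star b) := by
  ext1; funext p
  refine (star_opTensor (p.1.rep a) (p.2.rep b)).trans ?_
  rw [← map_star, ← map_star]
  rfl

lemma prodRep_comp_symmetrizeMap (α : Grading A) (β : Grading B) (p : State A × State B)
    (a : A) (b : B) :
    (prodRep p a b).comp (symmetrizeMap α β p) =
      (symmetrizeMap α β p).comp
        (prodRep ((p.1.symmetrize α).toState, (p.2.symmetrize β).toState) a b) := by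
  refine HilbertTensor.ext_of_denseRange (p.1.symmetrize α).denseRange_vec
    (p.2.symmetrize β).denseRange_vec fun c d => ?_
  rw [ContinuousLinearMap.comp_apply, ContinuousLinearMap.comp_apply, symmetrizeMap_vec,
    prodRep_vec]
  refine .trans ?_ (congrArg (symmetrizeMap α β p)
    (prodRep_vec ((p.1.symmetrize α).toState, (p.2.symmetrize β).toState) a c b d).symm)
  exact (symmetrizeMap_vec α β p (a * c) (b * d)).symm

variable (A B) in
/-- The space of the block of the minimal tensor product at a pair of states. -/
abbrev ProdSpace (p : State A × State B) : Type (max u v) := HilbertTensor p.1.H p.2.H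

/-- The block at a pair of states, as a representation. -/
def prodEval (p : State A × State B) :
    BlockDiagonal (ProdSpace A B) →⋆ₐ[ℂ] (ProdSpace A B p →L[ℂ] ProdSpace A B p) :=
  blockEval (ProdSpace A B) p

/-- The intertwined elements form a closed ⋆-subalgebra, so it suffices to treat elementary tensors,
whose adjoints are again elementary tensors. -/
lemma prodEval_comp_symmetrizeMap (α : Grading A) (β : Grading B) (p : State A × State B)
    (x : MinTensor A B) :
    (prodEval p x).comp (symmetrizeMap α β p) = (symmetrizeMap α β p).comp
      (prodEval ((p.1.symmetrize α).toState, (p.2.symmetrize β).toState) x) := by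
  have h : tensorAlgebra (prodGen (A := A) (B := B)) ≤
      intertwined (prodEval ((p.1.symmetrize α).toState, (p.2.symmetrize β).toState))
        (prodEval p) (symmetrizeMap α β p) := by
    refine StarSubalgebra.topologicalClosure_minimal (StarAlgebra.adjoin_le ?_)
      (isClosed_intertwined _ _ _)
    rintro _ ⟨a, b, rfl⟩
    refine ⟨prodRep_comp_symmetrizeMap α β p a b, ?_⟩
    rw [star_prodGen]
    exact prodRep_comp_symmetrizeMap α β p (star a) (star b)
  exact (h x.2).1

/-- An element of the minimal tensor product vanishes when its blocks at pairs of even states do. -/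
lemma minTensor_eq_zero (α : Grading A) (β : Grading B) (x : MinTensor A B)
    (hx : ∀ (ω : EvenState α) (φ : EvenState β), prodEval (ω.toState, φ.toState) x = 0) :
    x = 0 := by
  refine Subtype.ext ?_
  ext1; funext p
  change prodEval p x = 0
  refine HilbertTensor.ext_of_denseRange p.1.denseRange_vec p.2.denseRange_vec fun a b => ?_
  -- The class of `a ⊗ b` comes from the symmetrized block, which is even, so `x` acts there as
  -- zero.
  rw [← symmetrizeMap_vec α β p]
  have h := prodEval_comp_symmetrizeMap α β p x
  rw [hx, ContinuousLinearMap.comp_zero] at h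
  exact DFunLike.congr_fun h _

end Min

/-! ### Homomorphisms on closed algebras given by generators -/

section Generated

variable {C : Type u} [CStarAlgebra C] {D : Type v} [CStarAlgebra D] {S : Set C} {S' : Set D}

lemma continuous_of_starAlgHom (f : C →⋆ₐ[ℂ] D) : Continuous f :=
  AddMonoidHomClass.continuous_of_bound f 1 fun x => by
    simpa using NonUnitalStarAlgHom.norm_apply_le f x

lemma eq_of_eqOn_generators {f g : C →⋆ₐ[ℂ] D} (h : ∀ x ∈ S, f x = g x) (x : closedAlgebra S) :
    f x = g x := by
  have h1 : closedAlgebra S ≤ StarAlgHom.equalizer f g :=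
    StarSubalgebra.topologicalClosure_minimal (StarAlgebra.adjoin_le h)
      (isClosed_eq (continuous_of_starAlgHom f) (continuous_of_starAlgHom g))
  exact h1 x.2

/-- If a ⋆-homomorphism is injective on one closed algebra and maps its generators into a second
one, whose generators are images, then it restricts to an isomorphism; this is the inverse. -/
lemma exists_starAlgEquiv_of_generators (f : C →⋆ₐ[ℂ] D)
    (hf : ∀ x : closedAlgebra S, f x = 0 → x = 0) (h : ∀ x ∈ S, f x ∈ closedAlgebra S')
    (h' : ∀ y ∈ S', ∃ x : closedAlgebra S, f x = y) :
    ∃ κ : closedAlgebra S' ≃⋆ₐ[ℂ] closedAlgebra S, ∀ x y, κ y = x ↔ f x = y := by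
  have hmem : ∀ x : closedAlgebra S, f x ∈ closedAlgebra S' := by
    have h1 : closedAlgebra S ≤ (closedAlgebra S').comap f :=
      StarSubalgebra.topologicalClosure_minimal (StarAlgebra.adjoin_le h)
        ((StarSubalgebra.isClosed_topologicalClosure _).preimage (continuous_of_starAlgHom f))
    exact fun x => h1 x.2
  let g : closedAlgebra S →⋆ₐ[ℂ] D := f.comp (closedAlgebra S).subtype
  have hg : Function.Injective g := (injective_iff_map_eq_zero g).2 hf
  have hrange : closedAlgebra S' ≤ g.range := by
    refine StarSubalgebra.topologicalClosure_minimal (StarAlgebra.adjoin_le h') ?_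
    -- An injective ⋆-homomorphism of C⋆-algebras is isometric; its range is closed and so contains
    -- the closure of what the generators generate.
    exact (NonUnitalStarAlgHom.isometry g hg).isClosedEmbedding.isClosed_range
  let e := StarAlgEquiv.ofBijective (g.codRestrict (closedAlgebra S') hmem)
    ⟨(StarAlgHom.injective_codRestrict g _ hmem).2 hg, fun y => by
      obtain ⟨x, hx⟩ := hrange y.2
      exact ⟨x, Subtype.ext hx⟩⟩
  exact ⟨e.symm, fun x y => e.symm_apply_eq.trans (eq_comm.trans Subtype.ext_iff)⟩

end Generated

/-! ### The Klein isomorphism -/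

section Iso

variable {A : Type u} [CStarAlgebra A] [PartialOrder A] [StarOrderedRing A]
  {B : Type v} [CStarAlgebra B] [PartialOrder B] [StarOrderedRing B]

/-- A self-adjoint unitary which implements the grading. -/
structure Implements {A : Type u} [CStarAlgebra A] (u : A) (α : Grading A) : Prop where
  mem_unitary : u ∈ unitary A
  isSelfAdjoint : IsSelfAdjoint u
  apply_eq : ∀ a, α a = u * a * star u

variable {α : Grading A} {β : Grading B} {u : A}

lemma Implements.mul_self {A : Type u} [CStarAlgebra A] {u : A} {α : Grading A}
    (h : Implements u α) : u * u = 1 := by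
  have := (Unitary.mem_iff.1 h.mem_unitary).1
  rwa [h.isSelfAdjoint.star_eq] at this

lemma Implements.map_self {A : Type u} [CStarAlgebra A] {u : A} {α : Grading A}
    (h : Implements u α) : α u = u := by
  rw [h.apply_eq, h.isSelfAdjoint.star_eq, mul_assoc, h.mul_self, mul_one]

lemma Implements.map_mul_left {A : Type u} [CStarAlgebra A] {u : A} {α : Grading A}
    (h : Implements u α) (a : A) : α (u * a) = a * u := by
  rw [h.apply_eq, h.isSelfAdjoint.star_eq, ← mul_assoc, h.mul_self, one_mul]

/-- The operator `V_ω π_ω(u)`. When `u` implements the grading, it is a self-adjoint unitary in the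
commutant of `π_ω(A)`. -/
def EvenState.Z (ω : EvenState α) (u : A) : ω.H →L[ℂ] ω.H := ω.VOp * ω.rep u

lemma EvenState.Z_eq (ω : EvenState α) (h : Implements u α) : ω.Z u = ω.rep u * ω.VOp := by
  rw [Z, VOp_mul_rep, h.map_self]

/-- Both factors of `ω.Z u` implement `α`, and `α` is an involution. -/
lemma EvenState.Z_mul_rep (ω : EvenState α) (h : Implements u α) (a : A) :
    ω.Z u * ω.rep a = ω.rep a * ω.Z u := by
  rw [Z, mul_assoc, ← map_mul, VOp_mul_rep, h.map_mul_left, map_mul, mul_assoc, ← Z_eq ω h, Z]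

lemma EvenState.Z_mul_self (ω : EvenState α) (h : Implements u α) : ω.Z u * ω.Z u = 1 := by
  -- Reversing the factors of the second copy only makes the two copies of `ω.rep u` adjacent, so
  -- that they cancel.
  nth_rw 2 [Z_eq ω h]
  rw [Z, mul_assoc, ← mul_assoc (ω.rep u), ← map_mul, h.mul_self, map_one, one_mul, VOp_mul_self]

lemma EvenState.star_Z (ω : EvenState α) (h : Implements u α) : star (ω.Z u) = ω.Z u := by
  rw [Z, star_mul, star_VOp, ← map_star, h.isSelfAdjoint.star_eq, ← Z_eq ω h, Z]

variable (β) in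
/-- The Klein transformation of the block at a pair of even states. -/
def kleinUnitary (h : Implements u α) (p : EvenState α × EvenState β) :
    unitary (HilbertTensor p.1.H p.2.H →L[ℂ] HilbertTensor p.1.H p.2.H) :=
  ⟨kleinOp (p.1.Z u) p.2.VOp, kleinOp_mem_unitary (p.1.Z_mul_self h) p.2.VOp_mul_self
    (p.1.star_Z h) p.2.star_VOp⟩

lemma fermiRep_eq (p : EvenState α × EvenState β) (a : A) (b : B) :
    fermiRep α β p a b = opTensor (p.1.rep a) (p.2.rep (β.even b)) +
      opTensor (p.1.rep a * p.1.VOp) (p.2.rep (β.odd b)) := by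
  rw [fermiRep, opFermi, EvenState.evenOp_rep, EvenState.oddOp_rep]
  rfl

lemma fermiRep_even (p : EvenState α × EvenState β) (a : A) (b : B) :
    fermiRep α β p a (β.even b) = opTensor (p.1.rep a) (p.2.rep (β.even b)) := by
  -- Writing the zero operator as `0 • 0` lets linearity in the second factor remove the odd
  -- summand.
  rw [fermiRep_eq, β.even_even, β.odd_even, map_zero, ← zero_smul ℂ (0 : p.2.H →L[ℂ] p.2.H),
    opTensor_smul_right, zero_smul, add_zero]

lemma fermiRep_odd (p : EvenState α × EvenState β) (a : A) (b : B) :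
    fermiRep α β p a (β.odd b) = opTensor (p.1.rep a * p.1.VOp) (p.2.rep (β.odd b)) := by
  rw [fermiRep_eq, β.odd_odd, β.even_odd, map_zero, ← zero_smul ℂ (0 : p.2.H →L[ℂ] p.2.H),
    opTensor_smul_right, zero_smul, zero_add]

/-- The even part of `b` commutes with the Klein unitary. The odd part picks up `Z`, and `π(a) Z =
π(au) V` is the first factor of the Fermi product of `au` with an odd element. -/
lemma kleinUnitary_mul_prodRep (h : Implements u α) (p : EvenState α × EvenState β) (a : A)
    (b : B) :
    (kleinUnitary β h p : HilbertTensor p.1.H p.2.H →L[ℂ] HilbertTensor p.1.H p.2.H) *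
      opTensor (p.1.rep a) (p.2.rep b) =
      (fermiRep α β p a (β.even b) + fermiRep α β p (a * u) (β.odd b)) *
        (kleinUnitary β h p : HilbertTensor p.1.H p.2.H →L[ℂ] HilbertTensor p.1.H p.2.H) := by
  have he : p.2.VOp * p.2.rep (β.even b) = p.2.rep (β.even b) * p.2.VOp := by
    rw [EvenState.VOp_mul_rep, β.map_even]
  have ho : p.2.VOp * p.2.rep (β.odd b) = -(p.2.rep (β.odd b) * p.2.VOp) := by
    rw [EvenState.VOp_mul_rep, β.map_odd, map_neg, neg_mul]
  have hz : p.1.rep (a * u) * p.1.VOp = p.1.rep a * p.1.Z u := by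
    rw [map_mul, mul_assoc, p.1.Z_eq h]
  rw [fermiRep_even, fermiRep_odd, hz, add_mul]
  conv_lhs => rw [← β.even_add_odd b, map_add, opTensor_add_right, mul_add]
  exact congrArg₂ (· + ·) (kleinOp_commute_opTensor_even (p.1.Z_mul_rep h a) he)
    (kleinOp_mul_opTensor_odd (p.1.Z_mul_self h) (p.1.Z_mul_rep h a) ho)

lemma conj_kleinUnitary_prodRep (h : Implements u α) (p : EvenState α × EvenState β) (a : A)
    (b : B) :
    Unitary.conjStarAlgAut ℂ _ (kleinUnitary β h p) (opTensor (p.1.rep a) (p.2.rep b)) =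
      fermiRep α β p a (β.even b) + fermiRep α β p (a * u) (β.odd b) := by
  rw [Unitary.conjStarAlgAut_apply, kleinUnitary_mul_prodRep, mul_assoc,
    (Unitary.mem_iff.1 (kleinUnitary β h p).2).2, mul_one]

lemma fermiGen_add_right (a : A) (b b' : B) :
    fermiGen α β a (b + b') = fermiGen α β a b + fermiGen α β a b' := by
  ext1; funext p
  change fermiRep α β p a (b + b') = fermiRep α β p a b + fermiRep α β p a b'
  have he : β.even (b + b') = β.even b + β.even b' := by
    simp only [Grading.even, map_add]; module
  have ho : β.odd (b + b') = β.odd b + β.odd b' := by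
    simp only [Grading.odd, map_add]; module
  rw [fermiRep_eq, fermiRep_eq, fermiRep_eq, he, ho, map_add, map_add, opTensor_add_right,
    opTensor_add_right, add_add_add_comm]

lemma fermiGen_zero_right (a : A) : fermiGen α β a 0 = 0 := by
  have h := fermiGen_add_right (α := α) (β := β) a 0 0
  rw [add_zero] at h
  exact left_eq_add.1 h

variable (α β) in
/-- The space of the block of the Fermi tensor product at a pair of even states. -/
abbrev FermiSpace (p : EvenState α × EvenState β) : Type (max u v) := HilbertTensor p.1.H p.2.H

/-- The block of the minimal tensor product at a pair of even states, conjugated by the Klein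
transformation. -/
def kleinEval (h : Implements u α) (p : EvenState α × EvenState β) :
    BlockDiagonal (ProdSpace A B) →⋆ₐ[ℂ] (FermiSpace α β p →L[ℂ] FermiSpace α β p) :=
  StarAlgHom.comp
    (Unitary.conjStarAlgAut ℂ (FermiSpace α β p →L[ℂ] FermiSpace α β p)
      (kleinUnitary β h p)).toStarAlgHom
    (prodEval (p.1.toState, p.2.toState))

variable (β) in
/-- The block-diagonal operators of pairs of states, restricted to the pairs of even states and
conjugated by the Klein transformations. -/
def kleinHom (h : Implements u α) :
    BlockDiagonal (ProdSpace A B) →⋆ₐ[ℂ] BlockDiagonal (FermiSpace α β) :=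
  blockLift fun p => kleinEval h p

lemma kleinHom_prodGen (h : Implements u α) (a : A) (b : B) :
    kleinHom β h (prodGen a b) =
      fermiGen α β a (β.even b) + fermiGen α β (a * u) (β.odd b) := by
  ext1; funext p
  exact conj_kleinUnitary_prodRep h p a b

/-- The factor `u` in the odd term meets the one produced by `kleinHom`, and `u * u = 1`. This
exhibits a preimage of each Fermi generator and is also the formula for `κ`. -/
lemma kleinHom_klein (h : Implements u α) (a : A) (b : B) :
    kleinHom β h (prodGen a (β.even b) + prodGen (a * u) (β.odd b)) = fermiGen α β a b := by
  refine ((kleinHom β h).map_add' _ _).trans ?_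
  refine (congrArg₂ (· + ·) (kleinHom_prodGen h _ _) (kleinHom_prodGen h _ _)).trans ?_
  rw [β.even_even, β.odd_even, β.even_odd, β.odd_odd,
    mul_assoc, h.mul_self, mul_one, fermiGen_zero_right, add_zero, zero_add,
    ← fermiGen_add_right, β.even_add_odd]

lemma minTensor_eq_zero_of_kleinHom (h : Implements u α) (x : MinTensor A B)
    (hx : kleinHom β h x = 0) : x = 0 := by
  refine minTensor_eq_zero α β x fun ω φ => ?_
  have h2 : Unitary.conjStarAlgAut ℂ (FermiSpace α β (ω, φ) →L[ℂ] FermiSpace α β (ω, φ))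
      (kleinUnitary β h (ω, φ)) (prodEval (ω.toState, φ.toState) x) = 0 :=
    congrArg (fun T : BlockDiagonal (FermiSpace α β) => T (ω, φ)) hx
  exact (map_eq_zero_iff _ (EquivLike.injective _)).1 h2

/-- On generators both sides fix `b₊`, negate `b₋` and apply `α` to `a`; the factor `u` of the odd
term is undisturbed because `α` fixes it. -/
lemma kleinHom_prodConj (h : Implements u α) (x : MinTensor A B) :
    kleinHom β h (prodConj α β x) = fermiConj α β (kleinHom β h x) := by
  refine eq_of_eqOn_generators (f := (kleinHom β h).comp (prodConj α β))
    (g := (fermiConj α β).comp (kleinHom β h)) ?_ x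
  rintro _ ⟨a, b, rfl⟩
  change kleinHom β h (prodConj α β (prodGen a b)) = fermiConj α β (kleinHom β h (prodGen a b))
  rw [prodConj_prodGen, kleinHom_prodGen, kleinHom_prodGen]
  refine .trans ?_ ((fermiConj α β).map_add' _ _).symm
  refine .trans ?_ (congrArg₂ (· + ·) (fermiConj_fermiGen α β _ _)
    (fermiConj_fermiGen α β _ _)).symm
  rw [β.even_map, β.map_even, β.odd_map, β.map_odd, map_mul, h.map_self]

/-- The Klein isomorphism, as the inverse of the restriction of `kleinHom`. -/
lemma exists_kleinEquiv (h : Implements u α) :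
    ∃ κ : FermiTensor α β ≃⋆ₐ[ℂ] MinTensor A B, ∀ x y, κ y = x ↔ kleinHom β h x = y := by
  refine exists_starAlgEquiv_of_generators (kleinHom β h) (minTensor_eq_zero_of_kleinHom h) ?_ ?_
  · rintro _ ⟨a, b, rfl⟩
    rw [kleinHom_prodGen]
    exact add_mem (mem_closedAlgebra ⟨_, _, rfl⟩) (mem_closedAlgebra ⟨_, _, rfl⟩)
  · rintro _ ⟨a, b, rfl⟩
    exact ⟨minTmul a (β.even b) + minTmul (a * u) (β.odd b), kleinHom_klein h a b⟩

end Iso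

end FermiKlein

end

theorem proposition3p1 {A : Type u} {B : Type v}
    [CStarAlgebra A] [PartialOrder A] [StarOrderedRing A]
    [CStarAlgebra B] [PartialOrder B] [StarOrderedRing B]
    (α : FermiKlein.Grading A) (β : FermiKlein.Grading B)
    (u : A) (hu : u ∈ unitary A) (hsa : IsSelfAdjoint u)
    (hα : ∀ a, α a = u * a * star u) :
    ∃ κ : FermiKlein.FermiTensor α β ≃⋆ₐ[ℂ] FermiKlein.MinTensor A B,
      (∀ a b, κ (FermiKlein.fermiTmul α β a b) =
        FermiKlein.minTmul a (β.even b) + FermiKlein.minTmul (a * u) (β.odd b)) ∧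
      (∀ x, κ (FermiKlein.fermiGrading α β x) = FermiKlein.minGrading α β (κ x)) := by
  have h : FermiKlein.Implements u α := ⟨hu, hsa, hα⟩
  obtain ⟨κ, hκ⟩ := FermiKlein.exists_kleinEquiv (β := β) h
  -- As `κ` inverts `kleinHom`, each identity for `κ` is proved by applying `kleinHom` to its
  -- right-hand side.
  refine ⟨κ, fun a b => (hκ _ _).2 (FermiKlein.kleinHom_klein h a b), fun x => (hκ _ _).2 ?_⟩
  refine (FermiKlein.kleinHom_prodConj h (κ x)).trans ?_
  exact congrArg (FermiKlein.fermiConj α β) ((hκ _ _).1 rfl)
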